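/- Let $n\ge 2$ and let $(M^{2n},\omega)$ be a symplectic manifold, i.e. a smooth (Hausdorff, second countable) $2n$-dimensional manifold without boundary with a closed non-degenerate $2$-form $\omega$. For smooth functions $F,G$ on $M$ let $\{F,G\}=dF(\operatorname{sgrad}G)$ be their Poisson bracket, where $\operatorname{sgrad}G$ is the vector field with $\omega(\operatorname{sgrad}G,\cdot)=-dG$; in Darboux coordinates with $\omega=\sum_i dp_i\wedge dq_i$, $$\{F,G\}=\sum_{i=1}^n\Big(\frac{\partial F}{\partial q_i}\frac{\partial G}{\partial p_i}-\frac{\partial G}{\partial q_i}\frac{\partial F}{\partial p_i}\Big).$$ Let $\|\cdot\|_q$ denote the $L_q$-norm with respect to the volume form $\omega^n$, so that $\|H\|_q=\big(\int_M|H|^q\,\omega^n\big)^{1/q}$ for $1\le q<\infty$. For compact subsets $X_0,X_1,Y_0,Y_1\subset M$ with $X_0\cap X_1=Y_0\cap Y_1=\emptyset$ and $1\le q\le\infty$, set $$pb_4^q(X_0,X_1,Y_0,Y_1)=\inf_{(F,G)}\|\{F,G\}\|_q ,$$ where the infimum is over all pairs of smooth compactly supported functions $F,G$ on $M$ with $F|_{X_0}\le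 0$, $F|_{X_1}\ge 1$, $G|_{Y_0}\le 0$, $G|_{Y_1}\ge 1$. Theorem. Let $X_0,X_1,Y_0,Y_1$ be compact subsets of $M$ with $X_0\cap X_1=Y_0\cap Y_1=\emptyset$, and suppose that $X_1$ is a smooth embedded submanifold of $M$, with or without boundary, of dimension $d\le 2n-2$. Then $pb_4^q(X_0,X_1,Y_0,Y_1)=0$ for every real $q$ with $1\le q\le 2n-d$. -/

import Mathlib

open Set MeasureTheory
open scoped Manifold ContDiff ENNReal

noncomputable section

namespace SymplecticPB

/-- The model space `ℝ²ⁿ` with its Euclidean structure. -/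
abbrev Model (n : ℕ) : Type := EuclideanSpace ℝ (Fin (2 * n))

section

variable {n : ℕ} {M : Type*} [TopologicalSpace M] [ChartedSpace (Model n) M]

/-- The set of all smooth charts of `M`: the maximal smooth atlas. -/
abbrev smoothCharts (n : ℕ) (M : Type*) [TopologicalSpace M] [ChartedSpace (Model n) M] :
    Set (OpenPartialHomeomorph M (Model n)) :=
  IsManifold.maximalAtlas 𝓘(ℝ, Model n) ∞ M

/-- The expression of a differential 2-form in a chart `e`: its pullback under `e.symm`
(meaningful on `e.target`). -/
def localForm (form : ∀ x : M, TangentSpace 𝓘(ℝ, Model n) x [⋀^Fin 2]→L[ℝ] ℝ)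
    (e : OpenPartialHomeomorph M (Model n)) (y : Model n) : Model n [⋀^Fin 2]→L[ℝ] ℝ :=
  (form (e.symm y)).compContinuousLinearMap
    (mfderiv 𝓘(ℝ, Model n) 𝓘(ℝ, Model n) e.symm y)

variable (n M) in
/-- A symplectic form on `M`: a smooth, closed, non-degenerate differential 2-form. -/
structure SymplecticForm where
  /-- the value of the form at each point -/
  form : ∀ x : M, TangentSpace 𝓘(ℝ, Model n) x [⋀^Fin 2]→L[ℝ] ℝ
  smooth : ∀ e ∈ smoothCharts n M, ContDiffOn ℝ ∞ (localForm form e) e.target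
  closed : ∀ e ∈ smoothCharts n M, ∀ y ∈ e.target, extDeriv (localForm form e) y = 0
  nondegenerate : ∀ (x : M) (v : TangentSpace 𝓘(ℝ, Model n) x),
    (∀ w : TangentSpace 𝓘(ℝ, Model n) x, form x ![v, w] = 0) → v = 0

/-- The top exterior power `αⁿ = α ∧ ⋯ ∧ α` of an alternating 2-form, evaluated on `2n` vectors:
`αⁿ(v₀, …, v₂ₙ₋₁) = 2⁻ⁿ ∑_σ sign(σ) ∏ᵢ α(v_{σ(2i)}, v_{σ(2i+1)})`. -/
def topPower {V : Type*} [AddCommGroup V] [Module ℝ V] [TopologicalSpace V]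
    (α : V [⋀^Fin 2]→L[ℝ] ℝ) (v : Fin (2 * n) → V) : ℝ :=
  (1 / 2 ^ n : ℝ) * ∑ σ : Equiv.Perm (Fin (2 * n)), ((Equiv.Perm.sign σ : ℤ) : ℝ) *
    ∏ i : Fin n, α ![v (σ ⟨2 * i.val, by omega⟩), v (σ ⟨2 * i.val + 1, by omega⟩)]

namespace SymplecticForm

variable (Ω : SymplecticForm n M)

/-- Non-degeneracy in finite dimension: every covector is represented by a tangent vector. -/
theorem exists_dual (x : M) (φ : TangentSpace 𝓘(ℝ, Model n) x →L[ℝ] ℝ) :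
    ∃ v : TangentSpace 𝓘(ℝ, Model n) x,
      ∀ w : TangentSpace 𝓘(ℝ, Model n) x, Ω.form x ![v, w] = φ w := by
  let E := Model n
  let α : E [⋀^Fin 2]→L[ℝ] ℝ := Ω.form x
  let φ' : E →L[ℝ] ℝ := φ
  have hadd : ∀ v v' w : E, α ![v + v', w] = α ![v, w] + α ![v', w] := fun v v' w => by
    simpa using α.toMultilinearMap.cons_add ![w] v v'
  have hsmul : ∀ (c : ℝ) (v w : E), α ![c • v, w] = c * α ![v, w] := fun c v w => by
    simpa using α.toMultilinearMap.cons_smul ![w] c v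
  have hupd : ∀ v w : E, Function.update ![v, 0] 1 w = ![v, w] := fun v w => by
    ext i : 1
    fin_cases i <;> rfl
  have hadd2 : ∀ v w w' : E, α ![v, w + w'] = α ![v, w] + α ![v, w'] := fun v w w' => by
    simpa only [hupd] using α.map_update_add ![v, 0] 1 w w'
  have hsmul2 : ∀ (c : ℝ) (v w : E), α ![v, c • w] = c * α ![v, w] := fun c v w => by
    simpa only [hupd, smul_eq_mul] using α.map_update_smul ![v, 0] 1 c w
  let B : E →ₗ[ℝ] E →ₗ[ℝ] ℝ := LinearMap.mk₂ ℝ (fun v w => α ![v, w]) hadd hsmul hadd2 hsmul2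
  have hinj : Function.Injective B := by
    rw [← LinearMap.ker_eq_bot, LinearMap.ker_eq_bot']
    intro v hv
    exact Ω.nondegenerate x v fun w => LinearMap.congr_fun hv w
  have hdim : Module.finrank ℝ E = Module.finrank ℝ (Module.Dual ℝ E) :=
    Subspace.dual_finrank_eq.symm
  obtain ⟨v, hv⟩ := (LinearMap.injective_iff_surjective_of_finrank_eq_finrank hdim).1 hinj
    (φ' : E →ₗ[ℝ] ℝ)
  exact ⟨v, fun w => LinearMap.congr_fun hv w⟩

/-- The Hamiltonian vector field `sgrad F`, characterized by `Ω (sgrad F, ·) = -dF`. -/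
def sgrad (F : M → ℝ) (x : M) : TangentSpace 𝓘(ℝ, Model n) x :=
  (Ω.exists_dual x (-mfderiv 𝓘(ℝ, Model n) 𝓘(ℝ, ℝ) F x)).choose

theorem sgrad_spec (F : M → ℝ) (x : M) (w : TangentSpace 𝓘(ℝ, Model n) x) :
    Ω.form x ![Ω.sgrad F x, w] = -(mfderiv 𝓘(ℝ, Model n) 𝓘(ℝ, ℝ) F x w) :=
  (Ω.exists_dual x (-mfderiv 𝓘(ℝ, Model n) 𝓘(ℝ, ℝ) F x)).choose_spec w

/-- The Poisson bracket `{F, G} = dF (sgrad G)`. In Darboux coordinates, with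
`Ω = ∑ dpᵢ ∧ dqᵢ`, it is `∑ (∂F/∂qᵢ ∂G/∂pᵢ - ∂G/∂qᵢ ∂F/∂pᵢ)`. -/
def poisson (F G : M → ℝ) (x : M) : ℝ :=
  mfderiv 𝓘(ℝ, Model n) 𝓘(ℝ, ℝ) F x (Ω.sgrad G x)

/-- The measure that the volume form `Ωⁿ` induces on the domain of the chart `e` (and zero outside
it): in the coordinates of `e` it has the density `|Ωⁿ(∂₁, …, ∂₂ₙ)|` with respect to Lebesgue
measure. -/
def chartVolume [MeasurableSpace M] (e : OpenPartialHomeomorph M (Model n)) : Measure M :=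
  Measure.map e.symm ((volume.restrict e.target).withDensity fun y =>
    ENNReal.ofReal |topPower (localForm Ω.form e y)
      (fun i : Fin (2 * n) => EuclideanSpace.single i (1 : ℝ))|)

/-- The measure on `M` given by the volume form `Ωⁿ`. The chart measures agree on the overlaps of
chart domains, so the measure obtained by gluing them is their supremum, that is, the least measure
on `M` that is at least each of them. -/
def volumeMeasure [MeasurableSpace M] : Measure M :=
  ⨆ e ∈ smoothCharts n M, Ω.chartVolume e

/-- `F ∈ C^∞_c(M)`. -/
def IsTestFunction (n : ℕ) {M : Type*} [TopologicalSpace M] [ChartedSpace (Model n) M]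
    (F : M → ℝ) : Prop :=
  ContMDiff 𝓘(ℝ, Model n) 𝓘(ℝ, ℝ) ∞ F ∧ HasCompactSupport F

/-- The pairs `F, G ∈ C^∞_c(M)` with `F ≤ 0` on `X₀`, `F ≥ 1` on `X₁`, `G ≤ 0` on `Y₀` and
`G ≥ 1` on `Y₁`. -/
def admissiblePairs (n : ℕ) {M : Type*} [TopologicalSpace M] [ChartedSpace (Model n) M]
    (X₀ X₁ Y₀ Y₁ : Set M) : Set ((M → ℝ) × (M → ℝ)) :=
  {p | IsTestFunction n p.1 ∧ IsTestFunction n p.2 ∧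
    (∀ x ∈ X₀, p.1 x ≤ 0) ∧ (∀ x ∈ X₁, 1 ≤ p.1 x) ∧
    (∀ x ∈ Y₀, p.2 x ≤ 0) ∧ (∀ x ∈ Y₁, 1 ≤ p.2 x)}

/-- The Poisson bracket invariant `pb₄^q(X₀, X₁, Y₀, Y₁)`: the infimum of `‖{F, G}‖_q` over all
admissible pairs, as an extended non-negative real (an infimum over no pair would be `∞`). -/
def pb4 [MeasurableSpace M] (q : ℝ≥0∞) (X₀ X₁ Y₀ Y₁ : Set M) : ℝ≥0∞ :=
  ⨅ p ∈ admissiblePairs n X₀ X₁ Y₀ Y₁, eLpNorm (Ω.poisson p.1 p.2) q Ω.volumeMeasure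

end SymplecticForm

variable (n) in
/-- `X` is a `d`-dimensional smooth (embedded) submanifold of `M`, with or without boundary: around
each of its points there is a smooth chart of `M` that maps `X` to the coordinate subspace
`ℝᵈ × {0}`, or (with boundary) to the half-space `{z ∈ ℝᵈ × {0} | 0 ≤ z₀}` in it. -/
def IsSubmanifoldWithBoundary (d : ℕ) (X : Set M) : Prop :=
  ∀ x ∈ X, ∃ e ∈ smoothCharts n M, x ∈ e.source ∧
    ((∀ y ∈ e.source, y ∈ X ↔ ∀ i : Fin (2 * n), d ≤ i.val → e y i = 0) ∨
     (∀ y ∈ e.source, y ∈ X ↔ (∀ i : Fin (2 * n), d ≤ i.val → e y i = 0) ∧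
        ∀ i : Fin (2 * n), i.val = 0 → 0 ≤ e y i))

end

end SymplecticPB

end

/-!
The invariant vanishes because a submanifold of codimension `k = 2n - d ≥ 2` has zero
`W^{1,k}`-capacity. Fix one test function `G` separating `Y₀` from `Y₁`. Then
`|{F, G}| ≤ A |dF|` on compact sets, so it is enough to find cutoffs `F` of `X₁`, supported away
from `X₀`, with `‖dF‖_k` arbitrarily small; Hölder's inequality on a set of finite volume passes
from `k` to any `q ≤ k`.

In coordinates that flatten `X₁`, write `w` for the transverse coordinates. With a bump `ψ` equal
to `1` on the unit ball and supported in the ball of radius `2`, the average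
`f = N⁻¹ ∑_{j < N} ψ(4^{N+j} w)` equals `1` on `w = 0`. The differentials of the summands live on
disjoint annuli, on the `j`-th of which they are of size `4^{N+j}` while its volume is of order
`4^{-(N+j)k}`. Hence `∫ |df|^k` is of order `N^{-k} · N = N^{1-k}`, which tends to zero precisely
because `k ≥ 2` (`exists_logCutoff`, `exists_cutoff`).

Two facts bring this to the manifold. First, since the top power of a form is multiplied by the
determinant under a linear change of variables (`topPower_comp`), the volume measure is at most the
measure computed in any given chart on the domain of that chart
(`SymplecticForm.volumeMeasure_restrict_le`). Second, non-degeneracy and continuity of the form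
bound the Hamiltonian vector field of `G` in a chart (`SymplecticForm.eventually_abs_poisson_le`).
Local cutoffs are combined over a finite cover of the compact set `X₁` by
`1 - (1 - F₁)(1 - F₂)` (`SymplecticForm.IsSmallCutoff.union`).
-/

open Filter Topology

namespace SymplecticPB

/-! ### Logarithmic cutoff functions in Euclidean space -/

section LogCutoff

theorem dist_bounds_of_fderiv_bump_ne_zero {E : Type*} [NormedAddCommGroup E] [NormedSpace ℝ E]
    [HasContDiffBump E] {c : E} (ψ : ContDiffBump c) {u : E}
    (hu : fderiv ℝ ψ u ≠ 0) : ψ.rIn ≤ dist u c ∧ dist u c ≤ ψ.rOut := by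
  constructor
  · by_contra! h
    apply hu
    have : (ψ : E → ℝ) =ᶠ[𝓝 u] 1 := ψ.eventuallyEq_one_of_mem_ball h
    rw [this.fderiv_eq]
    exact fderiv_const_apply 1
  · have h1 : u ∈ tsupport (fderiv ℝ (ψ : E → ℝ)) := subset_tsupport _ hu
    have h2 := tsupport_fderiv_subset ℝ (f := (ψ : E → ℝ)) h1
    by_contra! h
    have : closure (Function.support (ψ : E → ℝ)) ⊆ Metric.closedBall c ψ.rOut := by
      rw [ψ.support_eq]; exact Metric.closure_ball_subset_closedBall
    exact absurd (Metric.mem_closedBall.1 (this h2)) (not_le.2 h)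

/-- The logarithmic cutoff `N⁻¹ ∑_{j < N} ψ(4^{N+j} P z)` of the kernel of `P`. At each point at
most one summand has a non-zero differential, so the `k`-th power of the differential of the average
is bounded by the sum of the `k`-th powers, with the factor `N⁻ᵏ`. -/
theorem exists_logCutoff {E : Type*} [NormedAddCommGroup E] [NormedSpace ℝ E]
    [HasContDiffBump E] [FiniteDimensional ℝ E] (P : E →L[ℝ] E) :
    ∃ C : ℝ, 0 ≤ C ∧ ∀ N : ℕ, 0 < N → ∃ f : E → ℝ, ContDiff ℝ ∞ f ∧
      (∀ z, f z ∈ Icc (0 : ℝ) 1) ∧ (∀ z, P z = 0 → f z = 1) ∧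
      (∀ z, 2 < 4 ^ N * ‖P z‖ → f z = 0) ∧
      ∀ k : ℕ, k ≠ 0 → ∀ z, ‖fderiv ℝ f z‖ ^ k ≤ (1 / N : ℝ) ^ k *
        ∑ j ∈ Finset.range N,
          {z : E | 4 ^ (N + j) * ‖P z‖ ≤ 2}.indicator (fun _ => (C * 4 ^ (N + j)) ^ k) z := by
  let ψ : ContDiffBump (0 : E) := ⟨1, 2, one_pos, one_lt_two⟩
  have hψ : ContDiff ℝ ∞ (ψ : E → ℝ) := ψ.contDiff
  obtain ⟨C₀, hC₀⟩ : ∃ C, ∀ u, ‖fderiv ℝ (ψ : E → ℝ) u‖ ≤ C :=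
    (ψ.hasCompactSupport.fderiv ℝ).exists_bound_of_continuous (hψ.continuous_fderiv (by simp))
  have hC₀' : 0 ≤ C₀ := (norm_nonneg _).trans (hC₀ 0)
  refine ⟨C₀ * ‖P‖, by positivity, fun N hN => ?_⟩
  have hN' : (0 : ℝ) < N := by exact_mod_cast hN
  let L : ℕ → E →L[ℝ] E := fun j => (4 ^ (N + j) : ℝ) • P
  have hLn : ∀ j z, ‖L j z‖ = 4 ^ (N + j) * ‖P z‖ := fun j z => by simp [L, norm_smul]
  refine ⟨fun z => (1 / N : ℝ) * ∑ j ∈ Finset.range N, ψ (L j z), ?_, ?_, ?_, ?_, ?_⟩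
  · exact contDiff_const.mul (ContDiff.sum fun j _ => hψ.comp (L j).contDiff)
  · intro z
    have h0 : 0 ≤ ∑ j ∈ Finset.range N, ψ (L j z) := Finset.sum_nonneg fun _ _ => ψ.nonneg
    have h1 : ∑ j ∈ Finset.range N, ψ (L j z) ≤ N := by
      simpa using Finset.sum_le_sum (s := Finset.range N)
        (f := fun j => ψ (L j z)) (g := fun _ => (1 : ℝ)) (fun _ _ => ψ.le_one)
    refine ⟨by positivity, ?_⟩
    show (1 / N : ℝ) * _ ≤ 1
    rw [one_div_mul_eq_div, div_le_one hN']
    exact h1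
  · intro z hz
    have : ∀ j, ψ (L j z) = 1 := fun j => by
      apply ψ.one_of_mem_closedBall
      simp [L, hz, ψ]
    simp [this, hN'.ne']
  · intro z hz
    have : ∀ j, ψ (L j z) = 0 := fun j => by
      apply ψ.zero_of_le_dist
      rw [dist_zero_right, hLn]
      refine hz.le.trans ?_
      gcongr
      · norm_num
      · omega
    simp [this]
  · intro k hk z
    let D : ℕ → E →L[ℝ] ℝ := fun j => (fderiv ℝ ψ (L j z)).comp (L j)
    have hD : fderiv ℝ (fun z => (1 / N : ℝ) * ∑ j ∈ Finset.range N, ψ (L j z)) z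
        = (1 / N : ℝ) • ∑ j ∈ Finset.range N, D j := by
      have h : ∀ j ∈ Finset.range N, HasFDerivAt (fun z => ψ (L j z)) (D j) z := fun j _ =>
        ((hψ.differentiable (by simp)).differentiableAt.hasFDerivAt).comp z (L j).hasFDerivAt
      exact ((HasFDerivAt.fun_sum h).const_mul _).fderiv
    have hz : ∀ j, D j ≠ 0 → 1 ≤ 4 ^ (N + j) * ‖P z‖ ∧ 4 ^ (N + j) * ‖P z‖ ≤ 2 := fun j hj => by
      have : fderiv ℝ ψ (L j z) ≠ 0 := fun h => hj (by simp [D, h])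
      simpa [hLn, ψ] using dist_bounds_of_fderiv_bump_ne_zero ψ this
    -- the annuli that carry the derivatives of the summands are pairwise disjoint
    have huniq : ∀ i j, D i ≠ 0 → D j ≠ 0 → ¬ i < j := fun i j hi hj hij => by
      have h1 := (hz i hi).1
      have h2 := (hz j hj).2
      have h3 : (4 : ℝ) ^ (N + i) * 4 ≤ 4 ^ (N + j) := by
        rw [← pow_succ]
        exact pow_le_pow_right₀ (by norm_num) (by omega)
      nlinarith [norm_nonneg (P z), mul_le_mul_of_nonneg_right h3 (norm_nonneg (P z))]
    have hnn : ∀ j ∈ Finset.range N, 0 ≤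
        {z : E | 4 ^ (N + j) * ‖P z‖ ≤ 2}.indicator (fun _ => (C₀ * ‖P‖ * 4 ^ (N + j)) ^ k) z :=
      fun j _ => indicator_nonneg (fun _ _ => by positivity) z
    rw [hD, norm_smul, mul_pow, Real.norm_of_nonneg (by positivity)]
    gcongr
    by_cases hex : ∃ j ∈ Finset.range N, D j ≠ 0
    · obtain ⟨j, hjN, hj⟩ := hex
      rw [Finset.sum_eq_single_of_mem j hjN fun i _ hij => by
        by_contra hi
        rcases lt_or_gt_of_ne hij with h | h
        · exact huniq i j hi hj h
        · exact huniq j i hj hi h]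
      refine le_trans ?_ (Finset.single_le_sum hnn hjN)
      rw [indicator_of_mem (show z ∈ {z : E | 4 ^ (N + j) * ‖P z‖ ≤ 2} from (hz j hj).2)]
      gcongr
      refine (ContinuousLinearMap.opNorm_comp_le _ _).trans ?_
      rw [mul_assoc]
      gcongr
      · exact hC₀ _
      · rw [norm_smul, mul_comm]; simp
    · push Not at hex
      rw [Finset.sum_eq_zero hex, norm_zero, zero_pow hk]
      exact Finset.sum_nonneg hnn

/-- The projection of `ℝᵐ` that sets the first `d` coordinates to zero. -/
noncomputable def transverseProj (m d : ℕ) :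
    EuclideanSpace ℝ (Fin m) →L[ℝ] EuclideanSpace ℝ (Fin m) :=
  LinearMap.toContinuousLinearMap
    { toFun := fun z => WithLp.toLp 2 fun i => if d ≤ i.val then z i else 0
      map_add' := fun z w => by ext i; by_cases h : d ≤ i.val <;> simp [h]
      map_smul' := fun c z => by ext i; by_cases h : d ≤ i.val <;> simp [h] }

theorem transverseProj_apply {m d : ℕ} (z : EuclideanSpace ℝ (Fin m)) (i : Fin m) :
    transverseProj m d z i = if d ≤ i.val then z i else 0 := rfl

/-- The part of a ball of radius `r` within distance `δ` of the coordinate plane `ℝᵈ` lies in a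
box with `d` sides of length `2r` and `m - d` sides of length `2δ`. -/
theorem volume_tube_le {m d : ℕ} (hd : d ≤ m) (y : EuclideanSpace ℝ (Fin m)) {r δ : ℝ}
    (hr : 0 ≤ r) (hδ : 0 ≤ δ) :
    volume (Metric.closedBall y r ∩ {z | ‖transverseProj m d z‖ ≤ δ}) ≤
      ENNReal.ofReal ((2 * r) ^ d * (2 * δ) ^ (m - d)) := by
  let B : Fin m → Set ℝ := fun i => if d ≤ i.val then Icc (-δ) δ else Icc (y i - r) (y i + r)
  have hsub : Metric.closedBall y r ∩ {z | ‖transverseProj m d z‖ ≤ δ} ⊆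
      WithLp.ofLp ⁻¹' (Set.pi univ B) := by
    rintro z ⟨hz, hz'⟩ i -
    simp only [B]
    split_ifs with h
    · have := (PiLp.norm_apply_le (transverseProj m d z) i).trans hz'
      rw [transverseProj_apply, if_pos h, Real.norm_eq_abs] at this
      exact abs_le.1 this
    · have := (PiLp.norm_apply_le (z - y) i).trans (mem_closedBall_iff_norm.1 hz)
      rw [Real.norm_eq_abs, PiLp.sub_apply] at this
      have := abs_le.1 this
      exact ⟨by linarith, by linarith⟩
  have hB : ∀ i, volume (B i) = ENNReal.ofReal (if d ≤ i.val then 2 * δ else 2 * r) := fun i => by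
    simp only [B]
    split_ifs
    · rw [Real.volume_Icc]; congr 1; ring
    · rw [Real.volume_Icc]; congr 1; ring
  refine (measure_mono hsub).trans ?_
  rw [(PiLp.volume_preserving_ofLp (Fin m)).measure_preimage
    (MeasurableSet.univ_pi fun i => by simp only [B]; split_ifs <;>
      exact measurableSet_Icc).nullMeasurableSet]
  rw [volume_pi_pi, Finset.prod_congr rfl fun i _ => hB i,
    ← ENNReal.ofReal_prod_of_nonneg fun i _ => by split_ifs <;> positivity]
  apply ENNReal.ofReal_le_ofReal
  rw [Finset.prod_ite, Finset.prod_const, Finset.prod_const]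
  have h1 : (Finset.univ.filter fun i : Fin m => ¬ d ≤ i.val).card = d := by
    have := Fin.card_filter_val_lt (n := m) (m := d)
    simp only [not_le]
    omega
  have h2 := Finset.card_filter_add_card_filter_not (s := (Finset.univ : Finset (Fin m)))
    (fun i : Fin m => d ≤ i.val)
  rw [h1, Finset.card_univ, Fintype.card_fin] at h2
  rw [h1, show (Finset.univ.filter fun i : Fin m => d ≤ i.val).card = m - d by omega, mul_comm]

/-- The coordinate plane `ℝᵈ ⊆ ℝᵐ` has zero `W^{1,m-d}`-capacity if its codimension is at least
two: some cutoff of its intersection with a ball has arbitrarily small differential in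
`L_{m-d}`. -/
theorem exists_cutoff {m d : ℕ} (hd : d + 2 ≤ m) (y : EuclideanSpace ℝ (Fin m)) {r δ : ℝ}
    (hr : 0 < r) (hδ : 0 < δ) :
    ∃ h : EuclideanSpace ℝ (Fin m) → ℝ, ContDiff ℝ ∞ h ∧ tsupport h ⊆ Metric.closedBall y r ∧
      (∀ z, h z ∈ Icc (0 : ℝ) 1) ∧
      (∀ z ∈ Metric.closedBall y (r / 2), (∀ i : Fin m, d ≤ i.val → z i = 0) → h z = 1) ∧
      eLpNorm (fderiv ℝ h) ((m - d : ℕ) : ℝ≥0∞) volume ≤ ENNReal.ofReal δ := by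
  let χ : ContDiffBump y := ⟨r / 2, r, by positivity, by linarith⟩
  have hχ : ContDiff ℝ ∞ (χ : EuclideanSpace ℝ (Fin m) → ℝ) := χ.contDiff
  obtain ⟨C₁, hC₁⟩ : ∃ C, ∀ u, ‖fderiv ℝ (χ : EuclideanSpace ℝ (Fin m) → ℝ) u‖ ≤ C :=
    (χ.hasCompactSupport.fderiv ℝ).exists_bound_of_continuous (hχ.continuous_fderiv (by simp))
  have hC₁' : 0 ≤ C₁ := (norm_nonneg _).trans (hC₁ 0)
  obtain ⟨C, hC, hcut⟩ := exists_logCutoff (transverseProj m d)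
  obtain ⟨k, hk⟩ : ∃ k, k = m - d := ⟨_, rfl⟩
  have hk2 : 2 ≤ k := by omega
  rw [← hk]
  let A : ℝ := 2 ^ k * C₁ ^ k * ((2 * r) ^ d * 4 ^ k) + 2 ^ k * C ^ k * ((2 * r) ^ d * 4 ^ k)
  -- `A / N` will bound the integral of the `k`-th power of the differential
  obtain ⟨N, hN⟩ := exists_nat_gt (max 0 (A / δ ^ k))
  have hN0 : (0 : ℝ) < N := (le_max_left _ _).trans_lt hN
  have hN1 : 0 < N := by exact_mod_cast hN0
  have hAN : A / N ≤ δ ^ k := by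
    have := (le_max_right _ _).trans hN.le
    rw [div_le_iff₀ (by positivity)] at this ⊢
    linarith
  obtain ⟨f, hf, hf01, hf1, hf0, hDf⟩ := hcut N hN1
  have hts : tsupport (fun z => χ z * f z) ⊆ Metric.closedBall y r :=
    (tsupport_mul_subset_left (f := (χ : EuclideanSpace ℝ (Fin m) → ℝ))).trans χ.tsupport_eq.le
  refine ⟨fun z => χ z * f z, hχ.mul hf, hts, fun z =>
    ⟨mul_nonneg χ.nonneg (hf01 z).1, mul_le_one₀ χ.le_one (hf01 z).1 (hf01 z).2⟩, ?_, ?_⟩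
  · intro z hz hz0
    show χ z * f z = 1
    rw [hf1 z (by ext i; rw [transverseProj_apply]; split_ifs with h <;> simp [*]),
      χ.one_of_mem_closedBall hz, one_mul]
  -- `S j` contains the points of the ball at which the bump at scale `4⁻ʲ` is non-zero
  let S : ℕ → Set (EuclideanSpace ℝ (Fin m)) := fun j =>
    Metric.closedBall y r ∩ {z | ‖transverseProj m d z‖ ≤ 2 / 4 ^ j}
  have hSm : ∀ j, MeasurableSet (S j) := fun j =>
    (Metric.isClosed_closedBall.inter
      (isClosed_le (transverseProj m d).continuous.norm continuous_const)).measurableSet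
  have hSv : ∀ j, volume (S j) ≤ ENNReal.ofReal ((2 * r) ^ d * (4 ^ k / (4 ^ j) ^ k)) := fun j => by
    refine (volume_tube_le (by omega) y hr.le (by positivity)).trans_eq ?_
    rw [← hk, ← div_pow]
    congr 3
    ring
  have hSiff : ∀ j z, z ∈ Metric.closedBall y r →
      (z ∈ S j ↔ 4 ^ j * ‖transverseProj m d z‖ ≤ 2) := fun j z hz => by
    simp only [S, mem_inter_iff, hz, true_and, mem_ofPred_eq]
    rw [le_div_iff₀' (by positivity)]
  have hpt : ∀ z, ‖fderiv ℝ (fun z => χ z * f z) z‖ₑ ^ k ≤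
      ENNReal.ofReal (2 ^ k * C₁ ^ k) * (S N).indicator 1 z + ∑ j ∈ Finset.range N,
        ENNReal.ofReal (2 ^ k * ((1 / N) ^ k * (C * 4 ^ (N + j)) ^ k)) *
          (S (N + j)).indicator 1 z := by
    intro z
    by_cases hz : z ∈ Metric.closedBall y r
    swap
    · have : fderiv ℝ (fun z => χ z * f z) z = 0 := by
        by_contra h
        exact hz (hts (tsupport_fderiv_subset ℝ (subset_tsupport _ h)))
      rw [← ofReal_norm, this, norm_zero, ENNReal.ofReal_zero, zero_pow (by omega)]
      exact zero_le
    have hind : ∀ c : ℝ, 0 ≤ c → ∀ j, ENNReal.ofReal c * (S j).indicator 1 z =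
        ENNReal.ofReal ({z | 4 ^ j * ‖transverseProj m d z‖ ≤ 2}.indicator (fun _ => c) z) := by
      intro c hc j
      by_cases h : 4 ^ j * ‖transverseProj m d z‖ ≤ 2
      · rw [indicator_of_mem ((hSiff j z hz).2 h), indicator_of_mem (by exact h)]; simp
      · rw [indicator_of_notMem (fun h' => h ((hSiff j z hz).1 h')),
          indicator_of_notMem (by exact h)]; simp
    have hnn : ∀ c : ℝ, 0 ≤ c → ∀ j,
        0 ≤ {z | 4 ^ j * ‖transverseProj m d z‖ ≤ 2}.indicator (fun _ => c) z :=
      fun c hc j => indicator_nonneg (fun _ _ => hc) z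
    rw [hind _ (by positivity), Finset.sum_congr rfl fun j _ => hind _ (by positivity) (N + j),
      ← ENNReal.ofReal_sum_of_nonneg fun j _ => hnn _ (by positivity) _,
      ← ENNReal.ofReal_add (hnn _ (by positivity) _)
        (Finset.sum_nonneg fun j _ => hnn _ (by positivity) _),
      ← ofReal_norm, ← ENNReal.ofReal_pow (norm_nonneg _)]
    apply ENNReal.ofReal_le_ofReal
    have hD : fderiv ℝ (fun z => χ z * f z) z = χ z • fderiv ℝ f z + f z • fderiv ℝ χ z :=
      fderiv_fun_mul (hχ.differentiable (by simp)).differentiableAt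
        (hf.differentiable (by simp)).differentiableAt
    have hle : ‖fderiv ℝ (fun z => χ z * f z) z‖ ≤
        {z | 4 ^ N * ‖transverseProj m d z‖ ≤ 2}.indicator (fun _ => C₁) z + ‖fderiv ℝ f z‖ := by
      rw [hD, add_comm]
      refine (norm_add_le _ _).trans (add_le_add ?_ ?_)
      · rw [norm_smul, Real.norm_of_nonneg (hf01 z).1]
        by_cases h : 4 ^ N * ‖transverseProj m d z‖ ≤ 2
        · rw [indicator_of_mem (by exact h)]
          exact (mul_le_of_le_one_left (norm_nonneg _) (hf01 z).2).trans (hC₁ z)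
        · rw [indicator_of_notMem (by exact h), hf0 z (not_le.1 h), zero_mul]
      · rw [norm_smul, Real.norm_of_nonneg χ.nonneg]
        exact mul_le_of_le_one_left (norm_nonneg _) χ.le_one
    calc _ ≤ _ := pow_le_pow_left₀ (norm_nonneg _) hle k
      _ ≤ 2 ^ (k - 1) * (({z | 4 ^ N * ‖transverseProj m d z‖ ≤ 2}.indicator (fun _ => C₁) z) ^ k
          + ‖fderiv ℝ f z‖ ^ k) := add_pow_le (hnn _ hC₁' _) (norm_nonneg _) k
      _ ≤ 2 ^ k * (({z | 4 ^ N * ‖transverseProj m d z‖ ≤ 2}.indicator (fun _ => C₁) z) ^ k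
          + (1 / N : ℝ) ^ k * ∑ j ∈ Finset.range N,
          {z | 4 ^ (N + j) * ‖transverseProj m d z‖ ≤ 2}.indicator
            (fun _ => (C * 4 ^ (N + j)) ^ k) z) := by
        have := hnn _ hC₁' N
        gcongr
        · norm_num
        · omega
        · exact hDf k (by omega) z
      _ = _ := by
        rw [mul_add, Finset.mul_sum, Finset.mul_sum]
        congr 1
        · by_cases h : 4 ^ N * ‖transverseProj m d z‖ ≤ 2
          · rw [indicator_of_mem (by exact h), indicator_of_mem (by exact h)]
          · rw [indicator_of_notMem (by exact h), indicator_of_notMem (by exact h),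
              zero_pow (by omega), mul_zero]
        · refine Finset.sum_congr rfl fun j _ => ?_
          by_cases h : 4 ^ (N + j) * ‖transverseProj m d z‖ ≤ 2
          · rw [indicator_of_mem (by exact h), indicator_of_mem (by exact h)]
          · rw [indicator_of_notMem (by exact h), indicator_of_notMem (by exact h)]; simp
  have hint : ∀ c : ℝ, 0 ≤ c → ∀ j, ∫⁻ z, ENNReal.ofReal c * (S j).indicator 1 z ≤
      ENNReal.ofReal (c * ((2 * r) ^ d * (4 ^ k / (4 ^ j) ^ k))) := fun c hc j => by
    rw [lintegral_const_mul _ (measurable_one.indicator (hSm j)), lintegral_indicator_one (hSm j),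
      ENNReal.ofReal_mul hc]
    gcongr
    exact hSv j
  have hm : ∀ (c : ℝ) j, Measurable fun z => ENNReal.ofReal c * (S j).indicator 1 z :=
    fun c j => (measurable_one.indicator (hSm j)).const_mul _
  have hmain : ∫⁻ z, ‖fderiv ℝ (fun z => χ z * f z) z‖ₑ ^ k ≤ ENNReal.ofReal (δ ^ k) := by
    refine (lintegral_mono hpt).trans ?_
    rw [lintegral_add_left (hm _ _), lintegral_finsetSum _ fun j _ => hm _ _]
    refine (add_le_add (hint _ (by positivity) _)
      (Finset.sum_le_sum fun j _ => hint _ (by positivity) _)).trans ?_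
    rw [← ENNReal.ofReal_sum_of_nonneg fun j _ => by positivity,
      ← ENNReal.ofReal_add (by positivity) (Finset.sum_nonneg fun j _ => by positivity)]
    apply ENNReal.ofReal_le_ofReal
    refine le_trans ?_ hAN
    have h4 : (N : ℝ) ≤ (4 ^ N) ^ k := by
      have h1 : N < 4 ^ N := Nat.lt_pow_self (by norm_num)
      have h2 : (4 : ℝ) ^ N ≤ (4 ^ N) ^ k := le_self_pow₀ (one_le_pow₀ (by norm_num)) (by omega)
      have h3 : (N : ℝ) < 4 ^ N := by exact_mod_cast h1
      linarith
    -- the only use of codimension at least two: `N · N⁻ᵏ ≤ N⁻¹`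
    have hNk : (N : ℝ) * N ≤ (N : ℝ) ^ k := by
      rw [← sq]
      exact pow_le_pow_right₀ (by exact_mod_cast hN1) hk2
    have hterm : ∀ j, 2 ^ k * ((1 / N) ^ k * (C * 4 ^ (N + j)) ^ k) *
        ((2 * r) ^ d * (4 ^ k / (4 ^ (N + j)) ^ k)) =
        2 ^ k * C ^ k * ((2 * r) ^ d * 4 ^ k) / (N : ℝ) ^ k := fun j => by
      rw [mul_pow, div_pow, one_pow]
      field_simp
    simp only [hterm, Finset.sum_const, Finset.card_range, nsmul_eq_mul, A, add_div]
    gcongr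
    · rw [← mul_div_assoc, ← mul_div_assoc]
      gcongr
    · rw [mul_div_assoc', div_le_div_iff₀ (by positivity) hN0]
      have : 0 ≤ 2 ^ k * C ^ k * ((2 * r) ^ d * 4 ^ k) := by positivity
      nlinarith [mul_le_mul_of_nonneg_left hNk this]
  have hp := eLpNorm_nnreal_pow_eq_lintegral (f := fderiv ℝ (fun z => χ z * f z))
    (μ := (volume : Measure (EuclideanSpace ℝ (Fin m)))) (p := (k : NNReal))
    (by exact_mod_cast (show k ≠ 0 by omega))
  simp only [NNReal.coe_natCast, ENNReal.rpow_natCast, ENNReal.coe_natCast] at hp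
  rw [← hp, ENNReal.ofReal_pow hδ.le] at hmain
  exact (ENNReal.pow_le_pow_left_iff (by omega)).1 hmain

end LogCutoff

/-! ### The top power of an alternating 2-form -/

section TopPower

variable {n : ℕ}

/-- The index `2k + a` of the `a`-th vector in the `k`-th of `n` consecutive pairs. -/
def pairIndex (k : Fin n) (a : Fin 2) : Fin (2 * n) := ⟨2 * k.val + a.val, by omega⟩

theorem pairIndex_inj {k k' : Fin n} {a a' : Fin 2} :
    pairIndex k a = pairIndex k' a' ↔ k = k' ∧ a = a' := by
  simp only [pairIndex, Fin.ext_iff]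
  omega

theorem exists_pairIndex_eq (i : Fin (2 * n)) : ∃ (k : Fin n) (a : Fin 2), i = pairIndex k a :=
  ⟨⟨i.val / 2, by omega⟩, ⟨i.val % 2, by omega⟩, Fin.ext (Nat.div_add_mod i.val 2).symm⟩

theorem prod_pairIndex_update {V : Type*} [AddCommGroup V] [Module ℝ V] [TopologicalSpace V]
    [DecidableEq (Fin (2 * n))] (α : V [⋀^Fin 2]→L[ℝ] ℝ) (v : Fin (2 * n) → V) (j : Fin n)
    (a : Fin 2) (x : V) :
    ∏ k : Fin n, α (fun b => Function.update v (pairIndex j a) x (pairIndex k b)) =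
      α (Function.update (fun b => v (pairIndex j b)) a x) *
        ∏ k ∈ Finset.univ.erase j, α (fun b => v (pairIndex k b)) := by
  rw [← Finset.mul_prod_erase _ _ (Finset.mem_univ j)]
  congr 1
  · congr 1
    ext b : 1
    simp [Function.update_apply, pairIndex_inj]
  · refine Finset.prod_congr rfl fun k hk => ?_
    congr 1
    ext b : 1
    simp [pairIndex_inj, Finset.ne_of_mem_erase hk]

/-- The multilinear map `v ↦ ∏ₖ α(v₂ₖ, v₂ₖ₊₁)`, whose alternatization is a multiple of
`topPower α`. -/
noncomputable def pairProduct {V : Type*} [AddCommGroup V] [Module ℝ V] [TopologicalSpace V]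
    (n : ℕ) (α : V [⋀^Fin 2]→L[ℝ] ℝ) : MultilinearMap ℝ (fun _ : Fin (2 * n) => V) ℝ where
  toFun v := ∏ k : Fin n, α (fun a => v (pairIndex k a))
  map_update_add' v i x y := by
    obtain ⟨j, a, rfl⟩ := exists_pairIndex_eq i
    simp only [prod_pairIndex_update, α.map_update_add, add_mul]
  map_update_smul' v i c x := by
    obtain ⟨j, a, rfl⟩ := exists_pairIndex_eq i
    simp only [prod_pairIndex_update, α.map_update_smul, smul_eq_mul, mul_assoc]

theorem topPower_eq_alternatization {V : Type*} [AddCommGroup V] [Module ℝ V] [TopologicalSpace V]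
    (α : V [⋀^Fin 2]→L[ℝ] ℝ) (v : Fin (2 * n) → V) :
    topPower α v = (1 / 2 ^ n : ℝ) * (MultilinearMap.alternatization (pairProduct n α)) v := by
  rw [MultilinearMap.alternatization_apply, topPower]
  congr 1
  refine Finset.sum_congr rfl fun σ _ => ?_
  rw [Units.smul_def, zsmul_eq_mul, MultilinearMap.domDomCongr_apply]
  congr 1
  refine Finset.prod_congr rfl fun k _ => ?_
  congr 1
  ext a : 1
  fin_cases a <;> rfl

/-- On a `2n`-dimensional space, a linear change of variables multiplies the top power by its
determinant. -/
theorem topPower_comp (α : Model n [⋀^Fin 2]→L[ℝ] ℝ) (L : Model n →L[ℝ] Model n)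
    (v : Fin (2 * n) → Model n) :
    topPower (α.compContinuousLinearMap L) v = L.det * topPower α v := by
  have h1 : topPower (α.compContinuousLinearMap L) v = topPower α (L ∘ v) := by
    simp only [topPower]
    congr 1
    refine Finset.sum_congr rfl fun σ _ => ?_
    congr 1
    refine Finset.prod_congr rfl fun i _ => ?_
    rw [ContinuousAlternatingMap.compContinuousLinearMap_apply]
    congr 1
    ext j : 1
    fin_cases j <;> rfl
  have h2 := (EuclideanSpace.basisFun (Fin (2 * n)) ℝ).toBasis.det_comp (L : Model n →ₗ[ℝ] Model n) v
  rw [h1, topPower_eq_alternatization, topPower_eq_alternatization,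
    AlternatingMap.eq_smul_basis_det (EuclideanSpace.basisFun (Fin (2 * n)) ℝ).toBasis
      (MultilinearMap.alternatization (pairProduct n α))]
  simp only [AlternatingMap.smul_apply, smul_eq_mul]
  erw [h2]
  rw [ContinuousLinearMap.det]
  ring

theorem continuous_topPower (v : Fin (2 * n) → Model n) :
    Continuous fun α : Model n [⋀^Fin 2]→L[ℝ] ℝ => topPower α v := by
  unfold topPower
  fun_prop

end TopPower

/-! ### The volume measure and the Poisson bracket in charts -/

section Charts

variable {n : ℕ} {M : Type*} [TopologicalSpace M] [ChartedSpace (Model n) M]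

theorem mdifferentiable_of_mem_smoothCharts [IsManifold 𝓘(ℝ, Model n) ∞ M]
    {e : OpenPartialHomeomorph M (Model n)}
    (he : e ∈ smoothCharts n M) : e.MDifferentiable 𝓘(ℝ, Model n) 𝓘(ℝ, Model n) :=
  ⟨(contMDiffOn_of_mem_maximalAtlas he).mdifferentiableOn (by simp),
    (contMDiffOn_symm_of_mem_maximalAtlas he).mdifferentiableOn (by simp)⟩

theorem localForm_apply (form : ∀ x : M, TangentSpace 𝓘(ℝ, Model n) x [⋀^Fin 2]→L[ℝ] ℝ)
    (e : OpenPartialHomeomorph M (Model n)) (y v w : Model n) :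
    localForm form e y ![v, w] = form (e.symm y)
      ![mfderiv 𝓘(ℝ, Model n) 𝓘(ℝ, Model n) e.symm y v,
        mfderiv 𝓘(ℝ, Model n) 𝓘(ℝ, Model n) e.symm y w] := by
  show form (e.symm y)
    (fun i => mfderiv 𝓘(ℝ, Model n) 𝓘(ℝ, Model n) e.symm y (![v, w] i)) = _
  congr 1
  ext j : 1
  fin_cases j <;> rfl

/-- The coordinate form at `e x`, expressed through the form at `x` itself rather than at
`e.symm (e x)`. -/
theorem localForm_chart_apply (form : ∀ x : M, TangentSpace 𝓘(ℝ, Model n) x [⋀^Fin 2]→L[ℝ] ℝ)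
    (e : OpenPartialHomeomorph M (Model n)) {x : M} (hx : x ∈ e.source) (v : Fin 2 → Model n) :
    localForm form e (e x) v = (form x : Model n [⋀^Fin 2]→L[ℝ] ℝ)
      (fun i => mfderiv 𝓘(ℝ, Model n) 𝓘(ℝ, Model n) e.symm (e x) (v i)) := by
  have h : ∀ x', x' = x →
      (form x' : Model n [⋀^Fin 2]→L[ℝ] ℝ) = (form x : Model n [⋀^Fin 2]→L[ℝ] ℝ) := by
    rintro _ rfl; rfl
  exact congrArg (fun α : Model n [⋀^Fin 2]→L[ℝ] ℝ =>
    α (fun i => mfderiv 𝓘(ℝ, Model n) 𝓘(ℝ, Model n) e.symm (e x) (v i))) (h _ (e.left_inv hx))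

theorem differentiableAt_transition [IsManifold 𝓘(ℝ, Model n) ∞ M]
    {e e' : OpenPartialHomeomorph M (Model n)}
    (he : e ∈ smoothCharts n M) (he' : e' ∈ smoothCharts n M) {y : Model n} (hy : y ∈ e'.target)
    (hye : e'.symm y ∈ e.source) : DifferentiableAt ℝ (e ∘ e'.symm) y :=
  mdifferentiableAt_iff_differentiableAt.1
    (((mdifferentiable_of_mem_smoothCharts he).mdifferentiableAt hye).comp y
      ((mdifferentiable_of_mem_smoothCharts he').mdifferentiableAt_symm hy))

/-- The coordinate form in the chart `e'` is the pullback of that in `e` under the transition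
map. -/
theorem localForm_transition [IsManifold 𝓘(ℝ, Model n) ∞ M]
    (form : ∀ x : M, TangentSpace 𝓘(ℝ, Model n) x [⋀^Fin 2]→L[ℝ] ℝ)
    {e e' : OpenPartialHomeomorph M (Model n)}
    (he : e ∈ smoothCharts n M) (he' : e' ∈ smoothCharts n M) {y : Model n} (hy : y ∈ e'.target)
    (hye : e'.symm y ∈ e.source) :
    localForm form e' y = (localForm form e (e (e'.symm y))).compContinuousLinearMap
      (fderiv ℝ (e ∘ e'.symm) y) := by
  have hed := mdifferentiable_of_mem_smoothCharts he
  have hed' := mdifferentiable_of_mem_smoothCharts he'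
  ext v
  rw [ContinuousAlternatingMap.compContinuousLinearMap_apply, localForm_chart_apply form e hye]
  have key : ∀ u : Model n, mfderiv 𝓘(ℝ, Model n) 𝓘(ℝ, Model n) e.symm (e (e'.symm y))
      (fderiv ℝ (e ∘ e'.symm) y u) = mfderiv 𝓘(ℝ, Model n) 𝓘(ℝ, Model n) e'.symm y u := by
    intro u
    have h1 : fderiv ℝ (e ∘ e'.symm) y u =
        mfderiv 𝓘(ℝ, Model n) 𝓘(ℝ, Model n) e (e'.symm y)
          (mfderiv 𝓘(ℝ, Model n) 𝓘(ℝ, Model n) e'.symm y u) := by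
      rw [← mfderiv_eq_fderiv]
      exact mfderiv_comp_apply y (hed.mdifferentiableAt hye) (hed'.mdifferentiableAt_symm hy) u
    rw [h1]
    exact DFunLike.congr_fun (hed.symm_comp_deriv hye)
      (mfderiv 𝓘(ℝ, Model n) 𝓘(ℝ, Model n) e'.symm y u)
  show (form (e'.symm y) : Model n [⋀^Fin 2]→L[ℝ] ℝ) _ = _
  congr 1
  ext i : 1
  exact (key (v i)).symm

end Charts

namespace SymplecticForm

variable {n : ℕ} {M : Type*} [TopologicalSpace M] [ChartedSpace (Model n) M]
  (Ω : SymplecticForm n M)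

section Volume

variable [MeasurableSpace M] [BorelSpace M]

/-- The density of the volume form `Ωⁿ` with respect to Lebesgue measure in the chart `e`. -/
noncomputable def chartDensity (e : OpenPartialHomeomorph M (Model n)) (y : Model n) : ℝ≥0∞ :=
  ENNReal.ofReal |topPower (localForm Ω.form e y)
    (fun i : Fin (2 * n) => EuclideanSpace.single i (1 : ℝ))|

theorem aemeasurable_symm_chartDensity (e : OpenPartialHomeomorph M (Model n)) :
    AEMeasurable e.symm ((volume.restrict e.target).withDensity (Ω.chartDensity e)) :=
  (e.continuousOn_symm.aemeasurable e.open_target.measurableSet).mono_ac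
    (withDensity_absolutelyContinuous _ _)

theorem chartVolume_apply (e : OpenPartialHomeomorph M (Model n)) {A : Set M}
    (hA : MeasurableSet A) :
    Ω.chartVolume e A = ∫⁻ y in e.symm ⁻¹' A ∩ e.target, Ω.chartDensity e y := by
  have h := Measure.map_apply_of_aemeasurable (Ω.aemeasurable_symm_chartDensity e) hA
  rw [withDensity_apply', Measure.restrict_restrict' e.open_target.measurableSet] at h
  exact h

/-- On the domain of the chart `e`, the volume computed in any other chart is at most the one
computed in `e`. -/
theorem chartVolume_apply_le [IsManifold 𝓘(ℝ, Model n) ∞ M]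
    {e e' : OpenPartialHomeomorph M (Model n)}
    (he : e ∈ smoothCharts n M) (he' : e' ∈ smoothCharts n M) {A : Set M} (hA : MeasurableSet A)
    (hAe : A ⊆ e.source) : Ω.chartVolume e' A ≤ Ω.chartVolume e A := by
  rw [chartVolume_apply Ω e' hA, chartVolume_apply Ω e hA]
  set S : Set (Model n) := e'.symm ⁻¹' A ∩ e'.target with hS
  have hSm : MeasurableSet S := by
    have h := MeasurableSet.subtype_image e'.open_target.measurableSet
      ((continuousOn_iff_continuous_domRestrict.1 e'.continuousOn_symm).measurable hA)
    convert h using 1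
    ext y
    simp [hS, and_comm]
  have hinj : InjOn (e ∘ e'.symm) S := fun y hy z hz h =>
    e'.symm.injOn hy.2 hz.2 (e.injOn (hAe hy.1) (hAe hz.1) h)
  have hdens : ∀ y ∈ S, Ω.chartDensity e' y =
      ENNReal.ofReal |(fderiv ℝ (e ∘ e'.symm) y).det| * Ω.chartDensity e ((e ∘ e'.symm) y) := by
    intro y hy
    rw [chartDensity, chartDensity, localForm_transition Ω.form he he' hy.2 (hAe hy.1),
      topPower_comp, abs_mul, ENNReal.ofReal_mul (abs_nonneg _)]
    rfl
  rw [setLIntegral_congr_fun hSm hdens, ← lintegral_image_eq_lintegral_abs_det_fderiv_mul volume hSm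
    (fun y hy => (differentiableAt_transition he he' hy.2 (hAe hy.1)).hasFDerivAt.hasFDerivWithinAt)
    hinj]
  apply lintegral_mono_set
  rintro _ ⟨y, hy, rfl⟩
  refine ⟨?_, e.map_source (hAe hy.1)⟩
  show e.symm (e (e'.symm y)) ∈ A
  rw [e.left_inv (hAe hy.1)]
  exact hy.1

/-- The upper bound for the volume measure on a chart domain: no other chart contributes more mass
there. -/
theorem volumeMeasure_restrict_le [IsManifold 𝓘(ℝ, Model n) ∞ M]
    {e : OpenPartialHomeomorph M (Model n)} (he : e ∈ smoothCharts n M) :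
    Ω.volumeMeasure.restrict e.source ≤ Ω.chartVolume e := by
  have hs := e.open_source.measurableSet
  -- a measure that is infinite off the chart domain dominates every chart measure
  have h : Ω.volumeMeasure ≤ Ω.chartVolume e + (⊤ : Measure M).restrict e.sourceᶜ := by
    refine iSup₂_le fun e' he' => ?_
    rw [← Measure.restrict_add_restrict_compl (μ := Ω.chartVolume e') hs]
    refine add_le_add ?_ (Measure.restrict_mono_measure le_top _)
    refine Measure.le_iff.2 fun A hA => ?_
    rw [Measure.restrict_apply hA]
    exact (Ω.chartVolume_apply_le he he' (hA.inter hs) inter_subset_right).trans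
      (measure_mono inter_subset_left)
  refine (Measure.restrict_mono_measure h _).trans ?_
  rw [Measure.restrict_add, Measure.restrict_restrict hs, inter_compl_self,
    Measure.restrict_empty, add_zero]
  exact Measure.restrict_le_self

end Volume

section Bracket

variable [IsManifold 𝓘(ℝ, Model n) ∞ M]

theorem localForm_nondegenerate {e : OpenPartialHomeomorph M (Model n)}
    (he : e ∈ smoothCharts n M) {y : Model n} (hy : y ∈ e.target) {v : Model n}
    (hv : ∀ w, localForm Ω.form e y ![v, w] = 0) : v = 0 := by
  have hd := (mdifferentiable_of_mem_smoothCharts he).symm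
  have h0 : mfderiv 𝓘(ℝ, Model n) 𝓘(ℝ, Model n) e.symm y v = 0 := by
    refine Ω.nondegenerate _ _ fun w => ?_
    obtain ⟨u, rfl⟩ := hd.mfderiv_surjective hy w
    exact (localForm_apply Ω.form e y v u).symm.trans (hv u)
  exact hd.mfderiv_injective hy (h0.trans (map_zero _).symm)

/-- Near a point of a chart, the bracket with a fixed smooth function is bounded by a multiple of
the differential of the other function in the coordinates of the chart. -/
theorem eventually_abs_poisson_le {e : OpenPartialHomeomorph M (Model n)}
    (he : e ∈ smoothCharts n M) {y₀ : Model n} (hy₀ : y₀ ∈ e.target) {G : M → ℝ}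
    (hG : ContMDiff 𝓘(ℝ, Model n) 𝓘(ℝ, ℝ) ∞ G) :
    ∃ A : ℝ, 0 ≤ A ∧ ∀ᶠ y in 𝓝 y₀, ∀ F : M → ℝ,
      MDifferentiableAt 𝓘(ℝ, Model n) 𝓘(ℝ, ℝ) F (e.symm y) →
      |Ω.poisson F G (e.symm y)| ≤ A * ‖fderiv ℝ (F ∘ e.symm) y‖ := by
  have hd := (mdifferentiable_of_mem_smoothCharts he).symm
  have hnhds : e.target ∈ 𝓝 y₀ := e.open_target.mem_nhds hy₀
  have hchain : ∀ {y}, y ∈ e.target → ∀ F : M → ℝ,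
      MDifferentiableAt 𝓘(ℝ, Model n) 𝓘(ℝ, ℝ) F (e.symm y) → ∀ u : Model n,
      fderiv ℝ (F ∘ e.symm) y u = mfderiv 𝓘(ℝ, Model n) 𝓘(ℝ, ℝ) F (e.symm y)
        (mfderiv 𝓘(ℝ, Model n) 𝓘(ℝ, Model n) e.symm y u) := by
    intro y hy F hF u
    rw [← mfderiv_eq_fderiv]
    exact mfderiv_comp_apply y hF (hd.mdifferentiableAt hy) u
  -- the coordinate expression of `G` has a locally bounded differential
  have hGc : ContDiffAt ℝ ∞ (G ∘ e.symm) y₀ :=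
    ((hG.comp_contMDiffOn (contMDiffOn_symm_of_mem_maximalAtlas he)).contMDiffAt hnhds).contDiffAt
  have hGb : ∀ᶠ y in 𝓝 y₀, ‖fderiv ℝ (G ∘ e.symm) y‖ < ‖fderiv ℝ (G ∘ e.symm) y₀‖ + 1 :=
    (hGc.continuousAt_fderiv (by simp)).norm.eventually_lt_const (by simp)
  -- the form at `y₀` is bounded below, and nearby forms are close to it
  let α : Model n → Model n [⋀^Fin 2]→L[ℝ] ℝ := localForm Ω.form e
  have hα : ContinuousAt α y₀ := ((Ω.smooth e he).continuousOn).continuousAt hnhds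
  obtain ⟨K, hK0, hK⟩ := LinearMap.exists_antilipschitzWith
    ((α y₀).curryLeft : Model n →ₗ[ℝ] Model n [⋀^Fin 1]→L[ℝ] ℝ) (by
      rw [LinearMap.ker_eq_bot']
      intro v hv
      refine Ω.localForm_nondegenerate he hy₀ fun w => ?_
      exact DFunLike.congr_fun hv ![w])
  have hK' : ∀ v, ‖v‖ ≤ K * ‖(α y₀).curryLeft v‖ := fun v => by
    simpa using hK.le_mul_norm_sub 0 v
  have hK0' : (0 : ℝ) < K := hK0
  have hαb : ∀ᶠ y in 𝓝 y₀, ‖α y₀ - α y‖ < 1 / (2 * K) := by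
    have : ContinuousAt (fun y => ‖α y₀ - α y‖) y₀ := (continuousAt_const.sub hα).norm
    exact this.eventually_lt_const (by simp only [sub_self, norm_zero]; positivity)
  refine ⟨2 * K * (‖fderiv ℝ (G ∘ e.symm) y₀‖ + 1), by positivity, ?_⟩
  filter_upwards [hGb, hαb, hnhds] with y hGy hαy hy F hF
  obtain ⟨V, hV⟩ : ∃ V : Model n, mfderiv 𝓘(ℝ, Model n) 𝓘(ℝ, Model n) e.symm y V =
    Ω.sgrad G (e.symm y) := hd.mfderiv_surjective hy (Ω.sgrad G (e.symm y))
  have hpo : Ω.poisson F G (e.symm y) = fderiv ℝ (F ∘ e.symm) y V := by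
    rw [hchain hy F hF V, hV]; rfl
  have hαV : ∀ w, α y ![V, w] = -fderiv ℝ (G ∘ e.symm) y w := fun w => by
    rw [hchain hy G (hG.mdifferentiable (by simp)).mdifferentiableAt w]
    have h := Ω.sgrad_spec G (e.symm y) (mfderiv 𝓘(ℝ, Model n) 𝓘(ℝ, Model n) e.symm y w)
    rw [← hV] at h
    exact (localForm_apply Ω.form e y V w).trans h
  have h1 : ‖(α y).curryLeft V‖ ≤ ‖fderiv ℝ (G ∘ e.symm) y₀‖ + 1 := by
    refine ContinuousAlternatingMap.opNorm_le_bound _ (by positivity) fun u => ?_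
    have hu : u = ![u 0] := by ext j : 1; fin_cases j; rfl
    have : (α y).curryLeft V u = -fderiv ℝ (G ∘ e.symm) y (u 0) := by
      rw [← hαV]
      conv_lhs => rw [hu]
      rfl
    rw [this, norm_neg]
    simp only [Finset.univ_unique, Finset.prod_singleton, Fin.default_eq_zero]
    exact (ContinuousLinearMap.le_opNorm _ _).trans (by gcongr)
  have h2 : ‖(α y₀).curryLeft V‖ ≤ ‖(α y).curryLeft V‖ + 1 / (2 * K) * ‖V‖ := by
    have h3 : (α y₀).curryLeft V = (α y).curryLeft V + (α y₀ - α y).curryLeft V := by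
      ext u; simp
    rw [h3]
    refine (norm_add_le _ _).trans (add_le_add le_rfl ?_)
    refine (ContinuousLinearMap.le_opNorm _ _).trans ?_
    rw [ContinuousAlternatingMap.norm_curryLeft]
    gcongr
  have h4 : ‖V‖ ≤ 2 * K * (‖fderiv ℝ (G ∘ e.symm) y₀‖ + 1) := by
    have h5 := (hK' V).trans (mul_le_mul_of_nonneg_left (h2.trans (add_le_add h1 le_rfl)) hK0'.le)
    have h6 : (K : ℝ) * (1 / (2 * K) * ‖V‖) = ‖V‖ / 2 := by field_simp
    rw [mul_add, h6] at h5
    linarith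
  rw [hpo, ← Real.norm_eq_abs]
  exact (ContinuousLinearMap.le_opNorm _ _).trans
    ((mul_le_mul_of_nonneg_left h4 (norm_nonneg _)).trans_eq (mul_comm _ _))

end Bracket

end SymplecticForm

/-! ### Cutoff functions on the manifold -/

theorem measurable_indicator_comp_chart {n : ℕ} {M : Type*} [TopologicalSpace M]
    [MeasurableSpace M] [BorelSpace M] (e : OpenPartialHomeomorph M (Model n))
    {u : Model n → ℝ} (hu : Measurable u) :
    Measurable (e.source.indicator (u ∘ e)) := by
  have hs := e.open_source.measurableSet
  refine measurable_of_restrict_of_restrict_compl hs ?_ ?_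
  · convert hu.comp (continuousOn_iff_continuous_domRestrict.1 e.continuousOn).measurable using 1
    ext p
    exact indicator_of_mem p.2 _
  · convert measurable_const (a := (0 : ℝ)) using 1
    ext p
    exact indicator_of_notMem p.2 _

namespace SymplecticForm

variable {n : ℕ} {M : Type*} [TopologicalSpace M] [ChartedSpace (Model n) M]

theorem exists_testFunction_separating [IsManifold 𝓘(ℝ, Model n) ∞ M] [T2Space M]
    [SecondCountableTopology M] {Y₀ Y₁ : Set M} (hY₀ : IsClosed Y₀) (hY₁ : IsCompact Y₁)
    (hY : Y₀ ∩ Y₁ = ∅) :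
    ∃ G : M → ℝ, IsTestFunction n G ∧ (∀ y ∈ Y₀, G y = 0) ∧ ∀ y ∈ Y₁, G y = 1 := by
  have : LocallyCompactSpace M := Manifold.locallyCompact_of_finiteDimensional 𝓘(ℝ, Model n)
  obtain ⟨K, hK, hYK⟩ := exists_compact_superset hY₁
  have hdisj : Disjoint (Y₀ ∪ (interior K)ᶜ) Y₁ := by
    rw [Set.disjoint_union_left]
    exact ⟨disjoint_iff_inter_eq_empty.2 hY, disjoint_compl_left_iff_subset.2 hYK⟩
  obtain ⟨G, hG0, hG1, -⟩ := exists_contMDiffMap_zero_one_of_isClosed 𝓘(ℝ, Model n) (n := ⊤)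
    (hY₀.union isOpen_interior.isClosed_compl) hY₁.isClosed hdisj
  refine ⟨G, ⟨G.contMDiff, HasCompactSupport.intro hK fun x hx =>
    hG0 (Or.inr fun h => hx (interior_subset h))⟩, fun y hy => hG0 (Or.inl hy), fun y hy => hG1 hy⟩

/-- `F` is a test function with values in `[0, 1]`, equal to `1` on `t` and to `0` on `X₀`, such
that `‖{F, G}‖_q ≤ ε`. The last condition is expressed through a measurable majorant `g` of
`|{F, G}|`, so that Minkowski's inequality applies without a proof that `{F, G}` is measurable. -/
def IsSmallCutoff [MeasurableSpace M] (Ω : SymplecticForm n M) (G : M → ℝ) (q : ℝ≥0∞)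
    (X₀ t : Set M) (ε : ℝ≥0∞) (F : M → ℝ) : Prop :=
  IsTestFunction n F ∧ (∀ p, F p ∈ Icc (0 : ℝ) 1) ∧ (∀ p ∈ X₀, F p = 0) ∧ (∀ p ∈ t, F p = 1) ∧
    ∃ g : M → ℝ, Measurable g ∧ (∀ p, |Ω.poisson F G p| ≤ g p) ∧ eLpNorm g q Ω.volumeMeasure ≤ ε

variable (Ω : SymplecticForm n M)

theorem poisson_eq_zero_of_eventuallyEq {F G : M → ℝ} {p : M} (h : F =ᶠ[𝓝 p] 0) :
    Ω.poisson F G p = 0 := by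
  rw [poisson, h.mfderiv_eq]
  have : mfderiv 𝓘(ℝ, Model n) 𝓘(ℝ, ℝ) (0 : M → ℝ) p = 0 := mfderiv_const
  rw [this]
  rfl

theorem isSmallCutoff_zero [MeasurableSpace M] (G : M → ℝ) (q : ℝ≥0∞) (X₀ : Set M) (ε : ℝ≥0∞) :
    Ω.IsSmallCutoff G q X₀ ∅ ε 0 :=
  ⟨⟨contMDiff_const, HasCompactSupport.zero⟩, fun _ => ⟨le_rfl, zero_le_one⟩, fun _ _ => rfl,
    fun _ h => h.elim, 0, measurable_const,
    fun p => by simp [Ω.poisson_eq_zero_of_eventuallyEq (EventuallyEq.refl (𝓝 p) 0)], by simp⟩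

/-- Cutoffs for two sets combine to `1 - (1 - F₁)(1 - F₂)`, a cutoff for their union. -/
theorem IsSmallCutoff.union [MeasurableSpace M] {Ω : SymplecticForm n M} {G : M → ℝ} {q : ℝ≥0∞}
    (hq : 1 ≤ q) {X₀ s t : Set M} {ε₁ ε₂ : ℝ≥0∞} {F₁ F₂ : M → ℝ}
    (h₁ : Ω.IsSmallCutoff G q X₀ s ε₁ F₁) (h₂ : Ω.IsSmallCutoff G q X₀ t ε₂ F₂) :
    Ω.IsSmallCutoff G q X₀ (s ∪ t) (ε₁ + ε₂) (F₁ + F₂ - F₁ * F₂) := by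
  obtain ⟨⟨hs₁, hc₁⟩, hI₁, hz₁, ho₁, g₁, hm₁, hb₁, hn₁⟩ := h₁
  obtain ⟨⟨hs₂, hc₂⟩, hI₂, hz₂, ho₂, g₂, hm₂, hb₂, hn₂⟩ := h₂
  refine ⟨⟨(hs₁.add hs₂).sub (hs₁.mul hs₂), (hc₁.add hc₂).sub hc₁.mul_right⟩, fun p => ?_,
    fun p hp => by simp [hz₁ p hp, hz₂ p hp], ?_, g₁ + g₂, hm₁.add hm₂, fun p => ?_,
    (eLpNorm_add_le hm₁.aestronglyMeasurable hm₂.aestronglyMeasurable hq).trans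
      (add_le_add hn₁ hn₂)⟩
  · obtain ⟨⟨a₁, b₁⟩, a₂, b₂⟩ := hI₁ p, hI₂ p
    simp only [Pi.add_apply, Pi.sub_apply, Pi.mul_apply]
    constructor <;> nlinarith
  · rintro p (hp | hp)
    · simp [ho₁ p hp]
    · simp [ho₂ p hp]
  · have hd₁ := (hs₁.mdifferentiable (by simp) p).hasMFDerivAt
    have hd₂ := (hs₂.mdifferentiable (by simp) p).hasMFDerivAt
    have hpo : Ω.poisson (F₁ + F₂ - F₁ * F₂) G p =
        (1 - F₂ p) * Ω.poisson F₁ G p + (1 - F₁ p) * Ω.poisson F₂ G p := by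
      have h := DFunLike.congr_fun ((hd₁.add hd₂).sub (hd₁.mul hd₂)).mfderiv (Ω.sgrad G p)
      have h' : Ω.poisson (F₁ + F₂ - F₁ * F₂) G p = (Ω.poisson F₁ G p + Ω.poisson F₂ G p) -
        (F₁ p * Ω.poisson F₂ G p + F₂ p * Ω.poisson F₁ G p) := h
      rw [h']; ring
    obtain ⟨⟨a₁, b₁⟩, a₂, b₂⟩ := hI₁ p, hI₂ p
    rw [hpo, Pi.add_apply]
    refine (abs_add_le _ _).trans (add_le_add ?_ ?_)
    · rw [abs_mul, abs_of_nonneg (by linarith)]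
      exact (mul_le_of_le_one_left (abs_nonneg _) (by linarith)).trans (hb₁ p)
    · rw [abs_mul, abs_of_nonneg (by linarith)]
      exact (mul_le_of_le_one_left (abs_nonneg _) (by linarith)).trans (hb₂ p)

theorem IsSmallCutoff.mono [MeasurableSpace M] {Ω : SymplecticForm n M} {G : M → ℝ} {q : ℝ≥0∞}
    {X₀ s t : Set M} {ε ε' : ℝ≥0∞} {F : M → ℝ} (hst : s ⊆ t) (hε : ε ≤ ε')
    (h : Ω.IsSmallCutoff G q X₀ t ε F) : Ω.IsSmallCutoff G q X₀ s ε' F := by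
  obtain ⟨h₁, h₂, h₃, h₄, g, h₅, h₆, h₇⟩ := h
  exact ⟨h₁, h₂, h₃, fun p hp => h₄ p (hst hp), g, h₅, h₆, h₇.trans hε⟩

theorem eventually_chartDensity_le {e : OpenPartialHomeomorph M (Model n)}
    (he : e ∈ smoothCharts n M) {y₀ : Model n} (hy₀ : y₀ ∈ e.target) :
    ∃ D : ℝ, ∀ᶠ y in 𝓝 y₀, Ω.chartDensity e y ≤ ENNReal.ofReal D := by
  have hα : ContinuousAt (localForm Ω.form e) y₀ :=
    (Ω.smooth e he).continuousOn.continuousAt (e.open_target.mem_nhds hy₀)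
  have hc : ContinuousAt (Ω.chartDensity e) y₀ := by
    have h := (continuous_topPower
      (fun i : Fin (2 * n) => EuclideanSpace.single i (1 : ℝ))).abs
    exact (ENNReal.continuous_ofReal.comp h).continuousAt.comp hα
  have hlt : Ω.chartDensity e y₀ < ⊤ := ENNReal.ofReal_lt_top
  obtain ⟨D, hD, hD'⟩ := exists_between hlt
  refine ⟨D.toReal, (hc.eventually_lt_const hD).mono fun y hy => ?_⟩
  rw [ENNReal.ofReal_toReal hD'.ne]
  exact hy.le

/-- The `L_q`-norm of a function carried by a compact set of a chart is bounded by its coordinate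
`L_k`-norm, for every exponent `k ≥ q`. -/
theorem exists_eLpNorm_le [IsManifold 𝓘(ℝ, Model n) ∞ M] [MeasurableSpace M] [BorelSpace M]
    {e : OpenPartialHomeomorph M (Model n)} (he : e ∈ smoothCharts n M) {B : Set (Model n)}
    (hB : IsCompact B) {D : ℝ} (hD : ∀ y ∈ B, Ω.chartDensity e y ≤ ENNReal.ofReal D)
    {q k : ℝ≥0∞} (hq1 : 1 ≤ q) (hqk : q ≤ k) (hk : k ≠ ⊤) :
    ∃ C : ℝ≥0∞, C ≠ ⊤ ∧ ∀ u : Model n → ℝ, Measurable u → Function.support u ⊆ B →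
      eLpNorm (e.source.indicator (u ∘ e)) q Ω.volumeMeasure ≤ eLpNorm u k volume * C := by
  have hqt : q ≠ ⊤ := ne_top_of_le_ne_top hk hqk
  set c := ENNReal.ofReal D
  set μ : Measure (Model n) := c • volume.restrict B with hμ
  have hμu : μ univ ≠ ⊤ := by
    rw [hμ, Measure.smul_apply, Measure.restrict_apply_univ, smul_eq_mul]
    exact ENNReal.mul_ne_top ENNReal.ofReal_ne_top hB.measure_lt_top.ne
  refine ⟨c ^ (1 / k).toReal * μ univ ^ (1 / q.toReal - 1 / k.toReal), ?_, fun u hu hsupp => ?_⟩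
  · refine ENNReal.mul_ne_top (ENNReal.rpow_ne_top_of_nonneg ENNReal.toReal_nonneg
      ENNReal.ofReal_ne_top) (ENNReal.rpow_ne_top_of_nonneg ?_ hμu)
    have : 0 < q.toReal := ENNReal.toReal_pos (by positivity) hqt
    rw [sub_nonneg]
    exact one_div_le_one_div_of_le this (ENNReal.toReal_mono hk hqk)
  have hgm : Measurable (e.source.indicator (u ∘ e)) := measurable_indicator_comp_chart e hu
  have hBm := hB.measurableSet
  set ν := (volume.restrict e.target).withDensity (Ω.chartDensity e)
  have hν : ν.restrict B ≤ μ := by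
    rw [restrict_withDensity hBm, Measure.restrict_restrict hBm]
    calc _ ≤ (volume.restrict (B ∩ e.target)).withDensity fun _ => c := by
          refine withDensity_mono ?_
          filter_upwards [ae_restrict_mem (hBm.inter e.open_target.measurableSet)] with y hy
          exact hD y hy.1
      _ ≤ μ := by
          rw [withDensity_const]
          refine Measure.le_iff.2 fun s _ => ?_
          simp only [hμ, Measure.smul_apply, smul_eq_mul]
          gcongr
          exact inter_subset_left
  calc eLpNorm (e.source.indicator (u ∘ e)) q Ω.volumeMeasure
      = eLpNorm (e.source.indicator (u ∘ e)) q (Ω.volumeMeasure.restrict e.source) :=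
        (eLpNorm_restrict_eq_of_support_subset support_indicator_subset).symm
    _ ≤ eLpNorm (e.source.indicator (u ∘ e)) q (Ω.chartVolume e) :=
        eLpNorm_mono_measure _ (Ω.volumeMeasure_restrict_le he)
    _ = eLpNorm (e.source.indicator (u ∘ e) ∘ e.symm) q ν :=
        eLpNorm_map_measure hgm.aestronglyMeasurable (Ω.aemeasurable_symm_chartDensity e)
    _ = eLpNorm u q ν := by
        refine eLpNorm_congr_ae ?_
        have : ∀ᵐ y ∂(volume.restrict e.target),
            (e.source.indicator (u ∘ e) ∘ e.symm) y = u y := by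
          filter_upwards [ae_restrict_mem e.open_target.measurableSet] with y hy
          rw [Function.comp_apply, indicator_of_mem (e.map_target hy), Function.comp_apply,
            e.right_inv hy]
        exact (withDensity_absolutelyContinuous _ _).ae_le this
    _ = eLpNorm u q (ν.restrict B) := (eLpNorm_restrict_eq_of_support_subset hsupp).symm
    _ ≤ eLpNorm u q μ := eLpNorm_mono_measure _ hν
    _ ≤ eLpNorm u k μ * μ univ ^ (1 / q.toReal - 1 / k.toReal) :=
        eLpNorm_le_eLpNorm_mul_rpow_measure_univ hqk hu.aestronglyMeasurable
    _ = eLpNorm u k volume * (c ^ (1 / k).toReal * μ univ ^ (1 / q.toReal - 1 / k.toReal)) := by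
        rw [hμ, eLpNorm_smul_measure_of_ne_top hk, eLpNorm_restrict_eq_of_support_subset hsupp,
          smul_eq_mul]
        ring

variable [IsManifold 𝓘(ℝ, Model n) ∞ M]

/-- Zero capacity near a point of `X₁`: the Euclidean cutoff, transported by a chart `e` in which
`X₁` lies in the coordinate plane `ℝᵈ`. -/
theorem exists_local_cutoff [T2Space M] [MeasurableSpace M] [BorelSpace M] {G : M → ℝ}
    (hG : ContMDiff 𝓘(ℝ, Model n) 𝓘(ℝ, ℝ) ∞ G) {X₀ X₁ : Set M} (hX₀ : IsClosed X₀)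
    {d : ℕ} (hd : d + 2 ≤ 2 * n) {q : ℝ≥0∞} (hq1 : 1 ≤ q) (hq : q ≤ ((2 * n - d : ℕ) : ℝ≥0∞))
    {e : OpenPartialHomeomorph M (Model n)} (he : e ∈ smoothCharts n M)
    (heX : ∀ y ∈ e.source, y ∈ X₁ → ∀ i : Fin (2 * n), d ≤ i.val → e y i = 0)
    {x : M} (hx : x ∈ e.source) (hx₀ : x ∉ X₀) :
    ∃ t ∈ 𝓝 x, ∀ ε : ℝ≥0∞, ε ≠ 0 → ∃ F, Ω.IsSmallCutoff G q X₀ (t ∩ X₁) ε F := by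
  have hy₀ : e x ∈ e.target := e.map_source hx
  obtain ⟨A, hA, hAev⟩ := Ω.eventually_abs_poisson_le he hy₀ hG
  obtain ⟨D, hDev⟩ : ∃ D, ∀ᶠ y in 𝓝 (e x), Ω.chartDensity e y ≤ ENNReal.ofReal D :=
    Ω.eventually_chartDensity_le he hy₀
  have hX₀ev : ∀ᶠ y in 𝓝 (e x), e.symm y ∉ X₀ := by
    refine (e.continuousAt_symm hy₀).eventually (hX₀.isOpen_compl.mem_nhds ?_)
    rwa [e.left_inv hx]
  obtain ⟨r, hr, hball⟩ := Metric.nhds_basis_closedBall.mem_iff.1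
    (hAev.and (hDev.and (hX₀ev.and (e.open_target.mem_nhds hy₀))))
  have hBc : IsCompact (Metric.closedBall (e x) r) := isCompact_closedBall _ _
  have hBt : Metric.closedBall (e x) r ⊆ e.target := fun y hy => (hball hy).2.2.2
  obtain ⟨C, hC, hLp⟩ := Ω.exists_eLpNorm_le he hBc (fun y hy => (hball hy).2.1) hq1 hq
    (ENNReal.natCast_ne_top _)
  refine ⟨e.source ∩ e ⁻¹' Metric.closedBall (e x) (r / 2), ?_, fun ε hε => ?_⟩
  · exact Filter.inter_mem (e.open_source.mem_nhds hx)
      (e.continuousAt hx (Metric.closedBall_mem_nhds _ (by positivity)))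
  obtain ⟨δ, hδ, hδε⟩ := ENNReal.exists_nnreal_pos_mul_lt
    (ENNReal.mul_ne_top (ENNReal.ofReal_ne_top (r := A)) hC) hε
  obtain ⟨h, hh, hht, hh01, hh1, hhn⟩ := exists_cutoff hd (e x) hr (δ := δ) hδ
  set K : Set M := e.symm '' Metric.closedBall (e x) r
  have hKc : IsCompact K := hBc.image_of_continuousOn (e.continuousOn_symm.mono hBt)
  have hKs : K ⊆ e.source := by
    rintro _ ⟨y, hy, rfl⟩
    exact e.map_target (hBt hy)
  let F : M → ℝ := e.source.indicator (h ∘ e)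
  have hFK : Function.support F ⊆ K := by
    intro p hp
    have hps : p ∈ e.source := by
      by_contra hps
      exact hp (indicator_of_notMem hps _)
    refine ⟨e p, hht (subset_tsupport _ ?_), e.left_inv hps⟩
    intro h0
    exact hp (by simp only [F]; rw [indicator_of_mem hps]; exact h0)
  have hFt : tsupport F ⊆ K := closure_minimal hFK hKc.isClosed
  have hFe : ∀ p ∈ e.source, F =ᶠ[𝓝 p] h ∘ e := fun p hp => by
    filter_upwards [e.open_source.mem_nhds hp] with p' hp'
    exact indicator_of_mem hp' _
  have hFs : ContMDiff 𝓘(ℝ, Model n) 𝓘(ℝ, ℝ) ∞ F := contMDiff_of_tsupport fun p hp => by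
    have hp' := hKs (hFt hp)
    exact ((hh.contMDiff.contMDiffAt).comp p ((contMDiffOn_of_mem_maximalAtlas he).contMDiffAt
      (e.open_source.mem_nhds hp'))).congr_of_eventuallyEq (hFe p hp')
  let u : Model n → ℝ := A • fun y => ‖fderiv ℝ h y‖
  have hum : Measurable u := ((hh.continuous_fderiv (by simp)).norm.measurable).const_smul A
  have husupp : Function.support u ⊆ Metric.closedBall (e x) r := fun y hy =>
    hht (tsupport_fderiv_subset ℝ (subset_tsupport _ fun h0 => hy (by simp [u, h0])))
  refine ⟨F, ⟨hFs, hKc.of_isClosed_subset (isClosed_tsupport _) hFt⟩, fun p => ?_, fun p hp => ?_,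
    ?_, e.source.indicator (u ∘ e), ?_, fun p => ?_, ?_⟩
  · by_cases hp : p ∈ e.source
    · simp only [F]
      rw [indicator_of_mem hp]
      exact hh01 _
    · simp only [F]
      rw [indicator_of_notMem hp]
      exact ⟨le_rfl, zero_le_one⟩
  · by_contra hne
    obtain ⟨y, hy, rfl⟩ := hFK hne
    exact (hball hy).2.2.1 hp
  · rintro p ⟨⟨hps, hpb⟩, hpX⟩
    simp only [F]
    rw [indicator_of_mem hps]
    exact hh1 _ hpb (heX p hps hpX)
  · exact measurable_indicator_comp_chart e hum
  · by_cases hp : p ∈ K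
    · obtain ⟨y, hy, rfl⟩ := hp
      have hyt := hBt hy
      rw [indicator_of_mem (e.map_target hyt), Function.comp_apply, e.right_inv hyt]
      have hFy : F ∘ e.symm =ᶠ[𝓝 y] h := by
        filter_upwards [e.open_target.mem_nhds hyt] with y' hy'
        simp only [F, Function.comp_apply]
        rw [indicator_of_mem (e.map_target hy'), Function.comp_apply, e.right_inv hy']
      have := (hball hy).1 F (hFs.mdifferentiable (by simp)).mdifferentiableAt
      rwa [hFy.fderiv_eq] at this
    · have hF0 : F =ᶠ[𝓝 p] 0 := notMem_tsupport_iff_eventuallyEq.1 fun h' => hp (hFt h')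
      rw [Ω.poisson_eq_zero_of_eventuallyEq hF0, abs_zero]
      exact indicator_nonneg (fun _ _ => mul_nonneg hA (norm_nonneg _)) p
  -- `‖{F, G}‖_q` is at most `A C ‖dh‖_k ≤ A C δ < ε`
  · refine (hLp u hum husupp).trans (le_trans ?_ hδε.le)
    have h1 : eLpNorm u ((2 * n - d : ℕ) : ℝ≥0∞) volume =
        ENNReal.ofReal A * eLpNorm (fderiv ℝ h) ((2 * n - d : ℕ) : ℝ≥0∞) volume := by
      rw [eLpNorm_const_smul, eLpNorm_norm, Real.enorm_of_nonneg hA]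
    rw [h1]
    calc _ ≤ ENNReal.ofReal A * ENNReal.ofReal δ * C := by gcongr
      _ = _ := by rw [ENNReal.ofReal_coe_nnreal]; ring

theorem exists_cutoff_of_isCompact [T2Space M] [MeasurableSpace M] [BorelSpace M] {G : M → ℝ}
    (hG : ContMDiff 𝓘(ℝ, Model n) 𝓘(ℝ, ℝ) ∞ G) {X₀ X₁ : Set M} (hX₀ : IsClosed X₀)
    (hX₁ : IsCompact X₁) (hX : X₀ ∩ X₁ = ∅) {d : ℕ} (hd : d + 2 ≤ 2 * n)
    (hsub : IsSubmanifoldWithBoundary n d X₁)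
    {q : ℝ≥0∞} (hq1 : 1 ≤ q) (hq : q ≤ ((2 * n - d : ℕ) : ℝ≥0∞)) {ε : ℝ≥0∞} (hε : ε ≠ 0) :
    ∃ F, Ω.IsSmallCutoff G q X₀ X₁ ε F := by
  suffices H : ∀ ε : ℝ≥0∞, ε ≠ 0 → ∃ F, Ω.IsSmallCutoff G q X₀ X₁ ε F from H ε hε
  refine hX₁.induction_on (p := fun t => ∀ ε : ℝ≥0∞, ε ≠ 0 → ∃ F, Ω.IsSmallCutoff G q X₀ t ε F)
    ?_ ?_ ?_ ?_
  · exact fun ε _ => ⟨0, Ω.isSmallCutoff_zero G q X₀ ε⟩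
  · intro s t hst ht ε hε
    obtain ⟨F, hF⟩ := ht ε hε
    exact ⟨F, hF.mono hst le_rfl⟩
  · intro s t hs ht ε hε
    have hε2 : ε / 2 ≠ 0 := by simp [hε]
    obtain ⟨F₁, hF₁⟩ := hs _ hε2
    obtain ⟨F₂, hF₂⟩ := ht _ hε2
    exact ⟨_, (hF₁.union hq1 hF₂).mono subset_rfl (ENNReal.add_halves ε).le⟩
  · intro x hx
    obtain ⟨e, he, hxe, h⟩ := hsub x hx
    have heX : ∀ y ∈ e.source, y ∈ X₁ → ∀ i : Fin (2 * n), d ≤ i.val → e y i = 0 := by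
      rcases h with h | h
      · exact fun y hy hyX => (h y hy).1 hyX
      · exact fun y hy hyX => ((h y hy).1 hyX).1
    have hx₀ : x ∉ X₀ := fun h => notMem_empty x (hX ▸ ⟨h, hx⟩)
    obtain ⟨t, ht, hF⟩ := Ω.exists_local_cutoff hG hX₀ hd hq1 hq he heX hxe hx₀
    exact ⟨t ∩ X₁, inter_mem (mem_nhdsWithin_of_mem_nhds ht) self_mem_nhdsWithin, hF⟩

end SymplecticForm

end SymplecticPB

theorem theorem1p5 {n : ℕ} (hn : 2 ≤ n)
    {M : Type*} [TopologicalSpace M] [T2Space M] [SecondCountableTopology M]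
    [ChartedSpace (SymplecticPB.Model n) M]
    [IsManifold 𝓘(ℝ, SymplecticPB.Model n) ∞ M]
    [MeasurableSpace M] [BorelSpace M]
    (Ω : SymplecticPB.SymplecticForm n M)
    {X₀ X₁ Y₀ Y₁ : Set M}
    (hX₀ : IsCompact X₀) (hX₁ : IsCompact X₁) (hY₀ : IsCompact Y₀) (hY₁ : IsCompact Y₁)
    (hX : X₀ ∩ X₁ = ∅) (hY : Y₀ ∩ Y₁ = ∅)
    {d : ℕ} (hd : d ≤ 2 * n - 2) (hsub : SymplecticPB.IsSubmanifoldWithBoundary n d X₁)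
    {q : ℝ≥0∞} (hq1 : 1 ≤ q) (hq : q ≤ ((2 * n - d : ℕ) : ℝ≥0∞)) :
    Ω.pb4 q X₀ X₁ Y₀ Y₁ = 0 := by
  obtain ⟨G, hG, hG0, hG1⟩ :=
    SymplecticPB.SymplecticForm.exists_testFunction_separating (n := n) hY₀.isClosed hY₁ hY
  refine nonpos_iff_eq_zero.1 (le_of_forall_gt fun ε hε => ?_)
  obtain ⟨ε', hε', hlt⟩ := exists_between hε
  obtain ⟨F, hF, -, hF0, hF1, g, -, hg, hgn⟩ := Ω.exists_cutoff_of_isCompact hG.1 hX₀.isClosed hX₁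
    hX (by omega) hsub hq1 hq hε'.ne'
  refine lt_of_le_of_lt ?_ hlt
  refine (iInf₂_le (F, G) ⟨hF, hG, fun x hx => (hF0 x hx).le, fun x hx => (hF1 x hx).ge,
    fun y hy => (hG0 y hy).le, fun y hy => (hG1 y hy).ge⟩).trans ?_
  exact (eLpNorm_mono_real hg).trans hgn
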